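/- An arithmetic formula for a positive integer $n$ is a full binary tree (left and right children are distinguished) whose leaves all have value $1$, whose other nodes are each labelled $+$ or $\times$ and have as value the sum, respectively the product, of the values of their two children, such that both children of every node labelled $\times$ have value at least $2$, and such that the root has value $n$. For integers $k \ge 0$ and $n \ge 1$, let $f_k(n)$ be the number of arithmetic formulas for $n$ with exactly $k$ nodes labelled $\times$. Then the series $$\sigma := \sum_{m=1}^{\infty} \frac{1}{4^{m-1}} \sum_{\substack{d \mid m \\ 1 < d < m}} f_0(d)\, f_0(m/d)$$ converges and, for every fixed integer $k \ge 0$, $$f_k(n) \sim \frac{\sigma^k}{4\sqrt{\pi}\, k!}\, 4^n\, n^{k-3/2} \qquad \text{as } n \to +\infty.$$ -/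

import Mathlib

open Filter Asymptotics

/-- Full binary trees whose leaves carry the constant `1` and whose internal nodes are labelled
`+` (`add`) or `×` (`mul`). -/
inductive ArithExpr : Type
  | one : ArithExpr
  | add : ArithExpr → ArithExpr → ArithExpr
  | mul : ArithExpr → ArithExpr → ArithExpr

namespace ArithExpr

/-- The value of the root. -/
def value : ArithExpr → ℕ
  | one => 1
  | add A B => A.value + B.value
  | mul A B => A.value * B.value

/-- The tree is an arithmetic formula: both children of every multiplicative node have
value at least `2`. -/
def IsFormula : ArithExpr → Prop
  | one => True
  | add A B => A.IsFormula ∧ B.IsFormula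
  | mul A B => A.IsFormula ∧ B.IsFormula ∧ 2 ≤ A.value ∧ 2 ≤ B.value

/-- The number of multiplicative nodes. -/
def mulCount : ArithExpr → ℕ
  | one => 0
  | add A B => A.mulCount + B.mulCount
  | mul A B => A.mulCount + B.mulCount + 1

theorem value_pos : ∀ A : ArithExpr, 0 < A.value
  | one => Nat.one_pos
  | add A _ => Nat.add_pos_left A.value_pos _
  | mul A B => Nat.mul_pos A.value_pos B.value_pos

/-- There are only finitely many arithmetic formulas of a given value, so counting them by
`Set.ncard` below is meaningful. -/
theorem finite_formulas (n : ℕ) : {A : ArithExpr | A.IsFormula ∧ A.value = n}.Finite := by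
  suffices h : ∀ n : ℕ, {A : ArithExpr | A.IsFormula ∧ A.value < n}.Finite from
    (h (n + 1)).subset fun A hA => ⟨hA.1, by have := hA.2; omega⟩
  intro n
  induction n with
  | zero => simp
  | succ n ih =>
    refine ((Set.finite_singleton one).union
      ((ih.image2 add ih).union (ih.image2 mul ih))).subset ?_
    rintro (_ | ⟨A, B⟩ | ⟨A, B⟩) ⟨hf, hv⟩
    · exact Or.inl rfl
    · have hA := A.value_pos
      have hB := B.value_pos
      simp only [value] at hv
      exact Or.inr (Or.inl ⟨A, ⟨hf.1, by omega⟩, B, ⟨hf.2, by omega⟩, rfl⟩)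
    · obtain ⟨h1, h2, h3, h4⟩ := hf
      simp only [value] at hv
      exact Or.inr (Or.inr ⟨A, ⟨h1, by nlinarith⟩, B, ⟨h2, by nlinarith⟩, rfl⟩)

end ArithExpr

/-- `numFormulas k n` is `f_k(n)`: the number of arithmetic formulas for `n` with exactly `k`
multiplications. -/
noncomputable def numFormulas (k n : ℕ) : ℕ :=
  {A : ArithExpr | A.IsFormula ∧ A.value = n ∧ A.mulCount = k}.ncard

/-- The proper Dirichlet convolution: the sum of `g d * h (n / d)` over the divisors `d` of `n`
with `1 < d < n`. -/
def properConv (g h : ℕ → ℕ) (n : ℕ) : ℕ :=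
  ∑ d ∈ n.divisors with 1 < d ∧ d < n, g d * h (n / d)

/-- The term of index `m` of the series defining `σ`. -/
noncomputable def sigmaTerm (m : ℕ) : ℝ :=
  1 / 4 ^ (m - 1) * (properConv (numFormulas 0) (numFormulas 0) m : ℝ)

/-- The constant `σ`, the sum of `sigmaTerm m` over all integers `m ≥ 1`. -/
noncomputable def sigmaConst : ℝ := ∑' m : ℕ+, sigmaTerm m

/-! Let `F_k` be the generating series of `f_k(n) / 4 ^ n`, so that the dominant singularity sits at
`1`. Splitting at the root gives `F_0 = X / 4 + F_0 ^ 2`, hence `1 - 2 F_0 = (1 - X) ^ (1 / 2)`, and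
for `k ≥ 1` it expresses `F_k` by the products `F_i F_j` with `i + j = k` and the Dirichlet-type
series `D_{ij}` with `i + j = k - 1`. A proper divisor `d` of `n` has `d + n / d ≤ n / 2 + 2`, so
`D_{ij}` converges beyond `1` (`absSummableAt_convSeries`). By induction `F_{k+1} = R_k (1 - X) ^
(-k - 1 / 2)` with `R_k` convergent beyond `1` (`regularPart_succ`, `absSummableAt_regularPart`). At
`1` the recurrence for `R_k` becomes that of the Catalan numbers, so `R_k(1) = catalan k * (σ / 4) ^
(k + 1)`. The coefficients of `(1 - X) ^ (-k - 1 / 2)` come from Wallis' product, and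
`halfBinom.tendsto_coeff_mul` transfers their growth to `F_{k+1}`. -/

open Finset.HasAntidiagonal (antidiagonal mem_antidiagonal)
open PowerSeries (coeff coeff_mul coeff_mk coeff_one coeff_X coeff_succ_X_mul)

/-! ### Recurrences for the number of formulas. -/

namespace ArithExpr

/-- The formulas of value `n` with exactly `k` multiplications. -/
noncomputable def formulas (k n : ℕ) : Finset ArithExpr :=
  (show {A : ArithExpr | A.IsFormula ∧ A.value = n ∧ A.mulCount = k}.Finite from
    (finite_formulas n).subset fun _ hA => ⟨hA.1, hA.2.1⟩).toFinset

theorem mem_formulas {k n : ℕ} {A : ArithExpr} :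
    A ∈ formulas k n ↔ A.IsFormula ∧ A.value = n ∧ A.mulCount = k := by
  simp [formulas]

theorem card_formulas (k n : ℕ) : (formulas k n).card = numFormulas k n :=
  (Set.ncard_eq_toFinset_card _ _).symm

-- Hypothesis `hP` says that an index is determined by any pair it contributes, which makes the
-- union disjoint.
open Classical in
theorem card_image_pairs {ι : Type*} (S : Finset ι) (P Q : ι → Finset ArithExpr)
    (c : ArithExpr → ArithExpr → ArithExpr)
    (hc : ∀ A B A' B', c A B = c A' B' → A = A' ∧ B = B')
    (hP : ∀ p ∈ S, ∀ q ∈ S, ∀ A ∈ P p, A ∈ P q → ∀ B ∈ Q p, B ∈ Q q → p = q) :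
    (S.biUnion fun p => (P p ×ˢ Q p).image fun z => c z.1 z.2).card =
      ∑ p ∈ S, (P p).card * (Q p).card := by
  rw [Finset.card_biUnion]
  · refine Finset.sum_congr rfl fun p _ => ?_
    rw [Finset.card_image_of_injective, Finset.card_product]
    rintro ⟨A, B⟩ ⟨A', B'⟩ h
    exact Prod.ext (hc _ _ _ _ h).1 (hc _ _ _ _ h).2
  · intro p hp q hq hpq
    rw [Function.onFun, Finset.disjoint_left]
    intro x hx hx'
    simp only [Finset.mem_image, Finset.mem_product, Prod.exists] at hx hx'
    obtain ⟨A, B, ⟨hA, hB⟩, rfl⟩ := hx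
    obtain ⟨A', B', ⟨hA', hB'⟩, h⟩ := hx'
    obtain ⟨rfl, rfl⟩ := hc _ _ _ _ h
    exact hpq (hP p hp q hq _ hA hA' _ hB hB')

/-- Formulas whose root is a sum. -/
noncomputable def addFormulas (k n : ℕ) : Finset ArithExpr := by
  classical
  exact (antidiagonal k ×ˢ antidiagonal n).biUnion fun p =>
    (formulas p.1.1 p.2.1 ×ˢ formulas p.1.2 p.2.2).image fun z => add z.1 z.2

/-- Formulas whose root is a product, with `k + 1` multiplications. -/
noncomputable def mulFormulas (k n : ℕ) : Finset ArithExpr := by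
  classical
  exact (antidiagonal k ×ˢ (n.divisors.filter fun d => 1 < d ∧ d < n)).biUnion fun p =>
    (formulas p.1.1 p.2 ×ˢ formulas p.1.2 (n / p.2)).image fun z => mul z.1 z.2

theorem card_addFormulas (k n : ℕ) : (addFormulas k n).card =
    ∑ p ∈ antidiagonal k, ∑ q ∈ antidiagonal n,
      numFormulas p.1 q.1 * numFormulas p.2 q.2 := by
  rw [addFormulas, card_image_pairs, Finset.sum_product]
  · simp only [card_formulas]
  · rintro A B A' B' h
    exact ⟨(add.inj h).1, (add.inj h).2⟩
  · rintro ⟨⟨a, b⟩, c, d⟩ _ ⟨⟨a', b'⟩, c', d'⟩ _ A hA hA' B hB hB'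
    simp only [mem_formulas] at hA hA' hB hB'
    simp only [Prod.mk.injEq]
    omega

theorem card_mulFormulas (k n : ℕ) : (mulFormulas k n).card =
    ∑ p ∈ antidiagonal k, properConv (numFormulas p.1) (numFormulas p.2) n := by
  rw [mulFormulas, card_image_pairs, Finset.sum_product]
  · simp only [card_formulas, properConv]
  · rintro A B A' B' h
    exact ⟨(mul.inj h).1, (mul.inj h).2⟩
  · rintro ⟨⟨a, b⟩, c⟩ _ ⟨⟨a', b'⟩, c'⟩ _ A hA hA' B hB hB'
    simp only [mem_formulas] at hA hA' hB hB'
    simp only [Prod.mk.injEq]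
    omega

theorem one_mem_formulas {k n : ℕ} : one ∈ formulas k n ↔ n = 1 ∧ k = 0 := by
  simp only [mem_formulas, IsFormula, value, mulCount, true_and]
  omega

theorem mem_addFormulas {k n : ℕ} {C : ArithExpr} :
    C ∈ addFormulas k n ↔ C ∈ formulas k n ∧ ∃ A B, C = add A B := by
  simp only [addFormulas, Finset.mem_biUnion, Finset.mem_image, Finset.mem_product,
    mem_antidiagonal, Prod.exists, mem_formulas]
  constructor
  · rintro ⟨i, j, a, b, ⟨hk, hn⟩, A, B, ⟨hA, hB⟩, rfl⟩
    refine ⟨⟨⟨hA.1, hB.1⟩, ?_, ?_⟩, A, B, rfl⟩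
    · simp only [value]; omega
    · simp only [mulCount]; omega
  · rintro ⟨⟨hf, hv, hm⟩, A, B, rfl⟩
    exact ⟨A.mulCount, B.mulCount, A.value, B.value, ⟨hm, hv⟩, A, B,
      ⟨⟨hf.1, rfl, rfl⟩, hf.2, rfl, rfl⟩, rfl⟩

theorem mem_mulFormulas {k n : ℕ} {C : ArithExpr} :
    C ∈ mulFormulas k n ↔ C ∈ formulas (k + 1) n ∧ ∃ A B, C = mul A B := by
  simp only [mulFormulas, Finset.mem_biUnion, Finset.mem_image, Finset.mem_product,
    mem_antidiagonal, Prod.exists, mem_formulas, Finset.mem_filter, Nat.mem_divisors]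
  constructor
  · rintro ⟨i, j, d, ⟨hk, ⟨⟨e, rfl⟩, hn⟩, hd, hdn⟩, A, B, ⟨hA, hB⟩, rfl⟩
    rw [Nat.mul_div_cancel_left _ (by omega)] at hB
    have he : 2 ≤ e := by
      by_contra! h
      interval_cases e <;> omega
    refine ⟨⟨⟨hA.1, hB.1, by omega, by omega⟩, ?_, ?_⟩, A, B, rfl⟩
    · simp only [value]; rw [hA.2.1, hB.2.1]
    · simp only [mulCount]; omega
  · rintro ⟨⟨hf, hv, hm⟩, A, B, rfl⟩
    obtain ⟨hA, hB, h2, h3⟩ := hf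
    simp only [value] at hv
    simp only [mulCount] at hm
    subst hv
    refine ⟨A.mulCount, B.mulCount, A.value, ⟨by omega, ⟨⟨_, rfl⟩, by positivity⟩, by omega,
      by nlinarith⟩, A, B, ⟨⟨hA, rfl, rfl⟩, hB, ?_, rfl⟩, rfl⟩
    rw [Nat.mul_div_cancel_left _ (by omega)]

theorem numFormulas_zero_left (n : ℕ) : numFormulas 0 n = (if n = 1 then 1 else 0) +
    ∑ q ∈ antidiagonal n, numFormulas 0 q.1 * numFormulas 0 q.2 := by
  classical
  have h : formulas 0 n = (if n = 1 then {one} else ∅) ∪ addFormulas 0 n := by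
    ext C
    rw [Finset.mem_union, mem_addFormulas]
    rcases C with _ | ⟨A, B⟩ | ⟨A, B⟩
    · rw [one_mem_formulas]; split_ifs <;> simp_all
    · split_ifs <;> simp
    · split_ifs <;> simp [mem_formulas, mulCount]
  rw [← card_formulas, h, Finset.card_union_of_disjoint, card_addFormulas]
  · split_ifs <;> simp
  · rw [Finset.disjoint_left]
    intro C hC hC'
    obtain ⟨_, A, B, rfl⟩ := mem_addFormulas.1 hC'
    split_ifs at hC <;> simp at hC

theorem numFormulas_succ_left (k n : ℕ) : numFormulas (k + 1) n =
    (∑ p ∈ antidiagonal (k + 1), ∑ q ∈ antidiagonal n,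
      numFormulas p.1 q.1 * numFormulas p.2 q.2) +
    ∑ p ∈ antidiagonal k, properConv (numFormulas p.1) (numFormulas p.2) n := by
  classical
  have h : formulas (k + 1) n = addFormulas (k + 1) n ∪ mulFormulas k n := by
    ext C
    rw [Finset.mem_union, mem_addFormulas, mem_mulFormulas]
    rcases C with _ | ⟨A, B⟩ | ⟨A, B⟩
    · simp [one_mem_formulas]
    · simp
    · simp
  rw [← card_formulas, h, Finset.card_union_of_disjoint, card_addFormulas, card_mulFormulas]
  rw [Finset.disjoint_left]
  intro C hC hC'
  obtain ⟨_, A, B, rfl⟩ := mem_addFormulas.1 hC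
  obtain ⟨_, A', B', h'⟩ := mem_mulFormulas.1 hC'
  simp at h'

theorem numFormulas_value_zero (k : ℕ) : numFormulas k 0 = 0 := by
  rw [← card_formulas, Finset.card_eq_zero, Finset.eq_empty_iff_forall_notMem]
  intro A hA
  exact A.value_pos.ne' (mem_formulas.1 hA).2.1

theorem numFormulas_zero_succ (n : ℕ) : numFormulas 0 (n + 1) = catalan n := by
  induction n using Nat.strong_induction_on with
  | _ n ih =>
    rw [numFormulas_zero_left]
    rcases n with _ | n
    · simp [Finset.Nat.antidiagonal_succ, numFormulas_value_zero]
    · rw [Finset.Nat.antidiagonal_succ_succ']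
      simp only [Finset.sum_cons, Finset.sum_map, Function.Embedding.prodMap,
        numFormulas_value_zero, catalan_succ']
      simp only [Function.Embedding.coeFn_mk, Prod.map, Function.Embedding.coeFn_mk]
      simp only [zero_mul, mul_zero, zero_add, Nat.succ_eq_add_one]
      rw [if_neg (by omega), zero_add]
      refine Finset.sum_congr rfl fun q hq => ?_
      rw [mem_antidiagonal] at hq
      rw [ih q.1 (by omega), ih q.2 (by omega)]

end ArithExpr

/-! ### Absolutely convergent power series and their value at `1`. -/

namespace PowerSeries

/-- Absolute convergence of a real power series at the point `R`. -/
def AbsSummableAt (R : ℝ) (F : PowerSeries ℝ) : Prop :=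
  Summable fun n => ‖coeff n F * R ^ n‖

namespace AbsSummableAt

variable {R : ℝ} {F G : PowerSeries ℝ}

theorem coeff_mul_mul_pow (R : ℝ) (F G : PowerSeries ℝ) (n : ℕ) : coeff n (F * G) * R ^ n =
    ∑ p ∈ antidiagonal n, coeff p.1 F * R ^ p.1 * (coeff p.2 G * R ^ p.2) := by
  rw [coeff_mul, Finset.sum_mul]
  refine Finset.sum_congr rfl fun p hp => ?_
  rw [← mem_antidiagonal.1 hp, pow_add]
  ring

theorem mul (hF : AbsSummableAt R F) (hG : AbsSummableAt R G) : AbsSummableAt R (F * G) := by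
  have h := summable_norm_sum_mul_antidiagonal_of_summable_norm
    (f := fun n => coeff n F * R ^ n) (g := fun n => coeff n G * R ^ n) hF hG
  exact h.congr fun n => by rw [coeff_mul_mul_pow]

theorem add (hF : AbsSummableAt R F) (hG : AbsSummableAt R G) : AbsSummableAt R (F + G) := by
  simp only [AbsSummableAt, map_add, add_mul]
  exact Summable.of_nonneg_of_le (fun _ => norm_nonneg _) (fun _ => norm_add_le _ _)
    (Summable.add hF hG)

theorem sub (hF : AbsSummableAt R F) (hG : AbsSummableAt R G) : AbsSummableAt R (F - G) := by
  simp only [AbsSummableAt, map_sub, sub_mul]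
  exact Summable.of_nonneg_of_le (fun _ => norm_nonneg _) (fun _ => norm_sub_le _ _)
    (Summable.add hF hG)

theorem zero : AbsSummableAt R 0 := by simp [AbsSummableAt]

theorem one : AbsSummableAt R 1 := by
  refine summable_of_ne_finset_zero (s := {0}) fun n hn => ?_
  rw [coeff_one, if_neg (by simpa using hn)]
  simp

theorem X : AbsSummableAt R PowerSeries.X := by
  refine summable_of_ne_finset_zero (s := {1}) fun n hn => ?_
  rw [coeff_X, if_neg (by simpa using hn)]
  simp

theorem pow (hF : AbsSummableAt R F) (k : ℕ) : AbsSummableAt R (F ^ k) := by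
  induction k with
  | zero => simpa using one
  | succ k ih => rw [pow_succ]; exact ih.mul hF

theorem sum {ι : Type*} {s : Finset ι} {f : ι → PowerSeries ℝ}
    (h : ∀ i ∈ s, AbsSummableAt R (f i)) : AbsSummableAt R (∑ i ∈ s, f i) :=
  Finset.sum_induction _ _ (fun _ _ => add) zero h

theorem mono {r : ℝ} (hr : 0 ≤ r) (hrR : r ≤ R) (hF : AbsSummableAt R F) : AbsSummableAt r F := by
  refine Summable.of_nonneg_of_le (fun _ => norm_nonneg _) (fun n => ?_) hF
  rw [norm_mul, norm_mul, norm_pow, norm_pow, Real.norm_of_nonneg hr,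
    Real.norm_of_nonneg (hr.trans hrR)]
  gcongr

theorem bounded (hF : AbsSummableAt R F) : ∃ K, ∀ n, ‖coeff n F * R ^ n‖ ≤ K :=
  ⟨_, fun n => hF.le_tsum n fun _ _ => norm_nonneg _⟩

end AbsSummableAt

/-- The sum of the coefficients, that is, the value at `1`. -/
noncomputable def valueAtOne (F : PowerSeries ℝ) : ℝ := ∑' n, coeff n F

section valueAtOne

variable {F G : PowerSeries ℝ}

theorem AbsSummableAt.norm_coeff (hF : AbsSummableAt 1 F) : Summable fun n => ‖coeff n F‖ := by
  simpa [AbsSummableAt] using hF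

theorem valueAtOne_mul (hF : AbsSummableAt 1 F) (hG : AbsSummableAt 1 G) :
    valueAtOne (F * G) = valueAtOne F * valueAtOne G := by
  simp only [valueAtOne, coeff_mul]
  exact (tsum_mul_tsum_eq_tsum_sum_antidiagonal_of_summable_norm hF.norm_coeff
    hG.norm_coeff).symm

theorem valueAtOne_add (hF : AbsSummableAt 1 F) (hG : AbsSummableAt 1 G) :
    valueAtOne (F + G) = valueAtOne F + valueAtOne G := by
  simp only [valueAtOne, map_add]
  exact hF.norm_coeff.of_norm.tsum_add hG.norm_coeff.of_norm

theorem valueAtOne_zero : valueAtOne 0 = 0 := by simp [valueAtOne]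

theorem valueAtOne_sum {ι : Type*} {s : Finset ι} {f : ι → PowerSeries ℝ}
    (h : ∀ i ∈ s, AbsSummableAt 1 (f i)) :
    valueAtOne (∑ i ∈ s, f i) = ∑ i ∈ s, valueAtOne (f i) := by
  classical
  induction s using Finset.induction_on with
  | empty => simp [valueAtOne_zero]
  | insert a s ha ih =>
    rw [Finset.sum_insert ha, Finset.sum_insert ha, valueAtOne_add, ih]
    · exact fun i hi => h i (Finset.mem_insert_of_mem hi)
    · exact h a (Finset.mem_insert_self _ _)
    · exact AbsSummableAt.sum fun i hi => h i (Finset.mem_insert_of_mem hi)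

theorem valueAtOne_one_sub_X : valueAtOne (1 - X) = 0 := by
  rw [valueAtOne, tsum_eq_sum (s := {0, 1})]
  · simp [coeff_one, coeff_X]
  · intro n hn
    simp only [Finset.mem_insert, Finset.mem_singleton, not_or] at hn
    simp [coeff_one, coeff_X, hn.1, hn.2]

theorem AbsSummableAt.one_sub_X {R : ℝ} : AbsSummableAt R (1 - PowerSeries.X) := one.sub X

theorem valueAtOne_one_sub_X_pow_succ (k : ℕ) : valueAtOne ((1 - X) ^ (k + 1)) = 0 := by
  rw [pow_succ, valueAtOne_mul (AbsSummableAt.one_sub_X.pow k) AbsSummableAt.one_sub_X,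
    valueAtOne_one_sub_X, mul_zero]

end valueAtOne

theorem coeff_mul_one_sub_X_zero (f : ℕ → ℝ) : coeff 0 ((1 - X) * mk f) = f 0 := by
  simp [sub_mul]

theorem coeff_mul_one_sub_X_succ (f : ℕ → ℝ) (n : ℕ) :
    coeff (n + 1) ((1 - X) * mk f) = f (n + 1) - f n := by
  simp [sub_mul, coeff_succ_X_mul]

end PowerSeries

/-! ### Coefficients of `(1 - X) ^ (-k - 1 / 2)` and their growth. -/

/-- The coefficient of `X ^ n` in `(1 - X) ^ (-k - 1 / 2)`. -/
noncomputable def halfBinom : ℕ → ℕ → ℝ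
  | 0, n => n.centralBinom / 4 ^ n
  | k + 1, n => halfBinom k n * ((n + k + 1 / 2) / (k + 1 / 2))

namespace halfBinom

theorem pos (k n : ℕ) : 0 < halfBinom k n := by
  induction k with
  | zero => have := n.centralBinom_pos; rw [halfBinom]; positivity
  | succ k ih => rw [halfBinom]; positivity

theorem zero_succ (n : ℕ) : halfBinom 0 (n + 1) = halfBinom 0 n * ((n + 1 / 2) / (n + 1)) := by
  have h : ((n : ℝ) + 1) * (n + 1).centralBinom = 2 * (2 * n + 1) * n.centralBinom := by
    exact_mod_cast Nat.succ_mul_centralBinom_succ n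
  rw [halfBinom, halfBinom, pow_succ]
  field_simp
  linear_combination 2 * h

theorem succ_right (k n : ℕ) :
    halfBinom k (n + 1) = halfBinom k n * ((n + k + 1 / 2) / (n + 1)) := by
  induction k with
  | zero => rw [zero_succ]; simp
  | succ k ih =>
    rw [halfBinom, halfBinom, ih]
    push_cast
    field_simp
    ring

theorem zero_right (k : ℕ) : halfBinom k 0 = 1 := by
  induction k with
  | zero => simp [halfBinom]
  | succ k ih =>
    rw [halfBinom, ih]
    field_simp
    push_cast
    ring

open PowerSeries in
theorem one_sub_X_mul (k : ℕ) : (1 - X) * mk (halfBinom (k + 1)) = mk (halfBinom k) := by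
  ext n
  rcases n with _ | n
  · rw [coeff_mul_one_sub_X_zero, coeff_mk, zero_right, zero_right]
  · rw [coeff_mul_one_sub_X_succ, coeff_mk, halfBinom, halfBinom, succ_right]
    push_cast
    field_simp
    ring

/-- A crude bound, uniform in `m`, that supplies the domination in `tendsto_coeff_mul`. Some loss in
`j` is unavoidable, as the coefficients decrease when `k = 0`. -/
theorem le_mul_add (k m j : ℕ) : halfBinom k m ≤ (j + 1) * halfBinom k (m + j) := by
  induction j with
  | zero => simp
  | succ j ih =>
    refine ih.trans ?_
    rw [← add_assoc, succ_right]
    have h := pos k (m + j)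
    have : ((j : ℝ) + 1) ≤ (j + 1 + 1) * (((m + j : ℕ) + k + 1 / 2) / ((m + j : ℕ) + 1)) := by
      push_cast
      rw [← mul_div_assoc, le_div_iff₀ (by positivity)]
      have : (0 : ℝ) ≤ m := by positivity
      have : (0 : ℝ) ≤ k := by positivity
      have : (0 : ℝ) ≤ j := by positivity
      have : (0 : ℝ) ≤ j * m := by positivity
      have : (0 : ℝ) ≤ j * k := by positivity
      nlinarith
    push_cast at this ⊢
    nlinarith [mul_le_mul_of_nonneg_right this h.le]

open Real in
theorem wallis (n : ℕ) : Wallis.W n * ((2 * n + 1) * halfBinom 0 n ^ 2) = 1 := by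
  induction n with
  | zero => simp [zero_right, Wallis.W]
  | succ n ih =>
    rw [Wallis.W_succ, zero_succ]
    refine Eq.trans ?_ ih
    push_cast
    field_simp
    ring

open Real Topology in
theorem tendsto_zero : Tendsto (fun n : ℕ => halfBinom 0 n * √n) atTop (𝓝 (1 / √π)) := by
  have h1 : Tendsto (fun n : ℕ => ((n : ℝ) / (2 * n + 1)) / Wallis.W n) atTop
      (𝓝 ((1 / 2) / (π / 2))) :=
    Stirling.tendsto_self_div_two_mul_self_add_one.div Wallis.tendsto_W_nhds_pi_div_two
      (by positivity)
  have h2 := h1.sqrt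
  have h3 : √((1 / 2) / (π / 2)) = 1 / √π := by
    rw [← Real.sqrt_one, ← Real.sqrt_div (by norm_num), Real.sqrt_one]
    congr 1
    field_simp
  rw [h3] at h2
  refine h2.congr fun n => ?_
  have hW := Wallis.W_pos n
  have h4 : (n : ℝ) / (2 * n + 1) / Wallis.W n = halfBinom 0 n ^ 2 * n := by
    have := wallis n
    rw [div_div, div_eq_iff (by positivity)]
    linear_combination (-(n : ℝ)) * this
  rw [h4, Real.sqrt_mul (sq_nonneg _), Real.sqrt_sq (pos 0 n).le]

open Topology in
/-- The coefficients grow like `n ^ (k - 1 / 2)`. -/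
theorem tendsto (k : ℕ) : Tendsto (fun n : ℕ => halfBinom k n / (n : ℝ) ^ ((k : ℝ) - 1 / 2))
    atTop (𝓝 (4 ^ k * (catalan k : ℝ)⁻¹ / ((k + 1).factorial * √Real.pi))) := by
  -- The limit is `1 / Γ(k + 1 / 2)`, written so that `catalan k` cancels against
  -- `valueAtOne_regularPart`.
  induction k with
  | zero =>
    refine (tendsto_zero.congr fun n => ?_).trans (by simp)
    rw [Nat.cast_zero, zero_sub, Real.rpow_neg (Nat.cast_nonneg n), div_inv_eq_mul,
      Real.sqrt_eq_rpow]
  | succ k ih =>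
    have h1 : Tendsto (fun n : ℕ => (1 + ((k : ℝ) + 1 / 2) / n) / (k + 1 / 2)) atTop
        (𝓝 ((1 + 0) / (k + 1 / 2))) :=
      (tendsto_const_nhds.add (tendsto_const_div_atTop_nhds_zero_nat _)).div_const _
    have hk : ((k : ℝ) + 2) * catalan (k + 1) = 2 * (2 * k + 1) * catalan k := by
      have h := Nat.succ_mul_centralBinom_succ k
      rw [← succ_mul_catalan_eq_centralBinom, ← succ_mul_catalan_eq_centralBinom] at h
      have h' : ((k : ℝ) + 1) * ((k + 1 + 1) * catalan (k + 1)) =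
          2 * (2 * k + 1) * ((k + 1) * catalan k) := by exact_mod_cast h
      refine mul_left_cancel₀ (by positivity : (k : ℝ) + 1 ≠ 0) ?_
      linear_combination h'
    have hc (j : ℕ) : (catalan j : ℝ) ≠ 0 := by
      have h := succ_mul_catalan_eq_centralBinom j
      have h' := j.centralBinom_ne_zero
      rw [← h] at h'
      exact_mod_cast right_ne_zero_of_mul h'
    convert (ih.mul h1).congr' ?_ using 2
    · have := hc k
      have := hc (k + 1)
      have hπ : √Real.pi ≠ 0 := (Real.sqrt_pos.2 Real.pi_pos).ne'
      rw [Nat.factorial_succ (k + 1)]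
      push_cast
      field_simp
      linear_combination (-2 * 4 ^ k : ℝ) * hk
    · filter_upwards [eventually_gt_atTop 0] with n hn
      have hn' : (0 : ℝ) < n := by exact_mod_cast hn
      have : ((k + 1 : ℕ) : ℝ) - 1 / 2 = (k - 1 / 2) + 1 := by push_cast; ring
      rw [this, Real.rpow_add_one hn'.ne', halfBinom]
      have := (Real.rpow_pos_of_pos hn' ((k : ℝ) - 1 / 2)).ne'
      field_simp
      ring

open Topology PowerSeries in
/-- Multiplying by a series that converges beyond `1` multiplies the coefficients
asymptotically by the value at `1`. -/
theorem tendsto_coeff_mul (k : ℕ) {H : PowerSeries ℝ} (hH : AbsSummableAt (5 / 4) H) {c : ℝ}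
    (hc : Tendsto (fun n : ℕ => halfBinom k n / (n : ℝ) ^ ((k : ℝ) - 1 / 2)) atTop (𝓝 c)) :
    Tendsto (fun n : ℕ => coeff n (H * mk (halfBinom k)) / (n : ℝ) ^ ((k : ℝ) - 1 / 2)) atTop
      (𝓝 (valueAtOne H * c)) := by
  have hratio : Tendsto (fun n : ℕ => halfBinom k n / halfBinom k (n + 1)) atTop (𝓝 1) := by
    have h : Tendsto (fun n : ℕ => 1 - ((k : ℝ) - 1 / 2) / ((n : ℝ) + (k + 1 / 2))) atTop
        (𝓝 (1 - 0)) :=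
      tendsto_const_nhds.sub (tendsto_const_nhds.div_atTop
        (tendsto_natCast_atTop_atTop.atTop_add tendsto_const_nhds))
    rw [sub_zero] at h
    refine h.congr fun n => ?_
    rw [succ_right]
    have := (pos k n).ne'
    field_simp
    ring
  have hshift (j : ℕ) : Tendsto (fun n : ℕ => halfBinom k n / halfBinom k (n + j)) atTop (𝓝 1) := by
    induction j with
    | zero =>
      refine tendsto_const_nhds.congr fun n => ?_
      rw [add_zero, div_self (pos k n).ne']
    | succ j ih =>
      have := ih.mul (hratio.comp (tendsto_add_atTop_nat j))
      rw [one_mul] at this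
      refine this.congr fun n => ?_
      have := (pos k (n + j)).ne'
      simp only [Function.comp_apply, ← add_assoc]
      field_simp
  have hsub (j : ℕ) : Tendsto (fun n : ℕ => if j ≤ n then
      coeff j H * (halfBinom k (n - j) / halfBinom k n) else 0) atTop (𝓝 (coeff j H)) := by
    rw [← tendsto_add_atTop_iff_nat j]
    simpa using (hshift j).const_mul (coeff j H)
  -- Dominated convergence for the Cauchy product divided by `halfBinom k n`, with dominating terms
  -- `4 * ‖coeff j H * (5 / 4) ^ j‖`.
  have hdom : Tendsto (fun n : ℕ => ∑' j, if j ≤ n then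
      coeff j H * (halfBinom k (n - j) / halfBinom k n) else 0) atTop
      (𝓝 (∑' j, coeff j H)) := by
    refine tendsto_tsum_of_dominated_convergence (Summable.mul_left 4 hH) hsub
      (Eventually.of_forall fun n j => ?_)
    split_ifs with hj
    · have h1 : halfBinom k (n - j) / halfBinom k n ≤ j + 1 := by
        rw [div_le_iff₀ (pos k n)]
        simpa [Nat.sub_add_cancel hj] using le_mul_add k (n - j) j
      have h2 : (0 : ℝ) ≤ halfBinom k (n - j) / halfBinom k n :=
        (div_pos (pos _ _) (pos _ _)).le
      -- Bernoulli's inequality gives `1 + j / 4 ≤ (5 / 4) ^ j`.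
      have h3 : (j : ℝ) + 1 ≤ 4 * (5 / 4) ^ j := by
        have := one_add_mul_le_pow (by norm_num : (-2 : ℝ) ≤ 1 / 4) j
        norm_num at this
        linarith
      rw [norm_mul, norm_mul, Real.norm_of_nonneg h2,
        Real.norm_of_nonneg (by positivity : (0 : ℝ) ≤ (5 / 4) ^ j)]
      nlinarith [mul_le_mul_of_nonneg_left (h1.trans h3) (norm_nonneg (coeff j H))]
    · rw [norm_zero]; positivity
  refine (hdom.mul hc).congr fun n => ?_
  rw [coeff_mul, tsum_eq_sum (s := Finset.range (n + 1)),
    Finset.Nat.sum_antidiagonal_eq_sum_range_succ_mk, ← mul_div_assoc, Finset.sum_mul]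
  · congr 1
    refine Finset.sum_congr rfl fun j hj => ?_
    rw [if_pos (by simpa [Nat.lt_succ_iff] using hj), coeff_mk]
    have := (pos k n).ne'
    field_simp
  · intro j hj
    rw [if_neg (by simpa [Nat.lt_succ_iff] using hj)]

end halfBinom

/-! ### Generating series and their factorization. -/

namespace ArithExpr

open PowerSeries

/-- The generating series of `numFormulas k n / 4 ^ n`. -/
noncomputable def formulaSeries (k : ℕ) : PowerSeries ℝ := mk fun n => (numFormulas k n : ℝ) / 4 ^ n

/-- The generating series of `properConv (numFormulas i) (numFormulas j) n / 4 ^ n`. -/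
noncomputable def convSeries (i j : ℕ) : PowerSeries ℝ :=
  mk fun n => (properConv (numFormulas i) (numFormulas j) n : ℝ) / 4 ^ n

theorem coeff_formulaSeries_mul (i j n : ℕ) : coeff n (formulaSeries i * formulaSeries j) =
    (∑ q ∈ antidiagonal n, numFormulas i q.1 * numFormulas j q.2 : ℕ) / 4 ^ n := by
  rw [coeff_mul]
  push_cast
  rw [Finset.sum_div]
  refine Finset.sum_congr rfl fun q hq => ?_
  rw [formulaSeries, formulaSeries, coeff_mk, coeff_mk, ← mem_antidiagonal.1 hq, pow_add,
    div_mul_div_comm]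

theorem formulaSeries_zero :
    formulaSeries 0 = C (1 / 4) * X + formulaSeries 0 * formulaSeries 0 := by
  ext n
  rw [map_add, coeff_formulaSeries_mul, formulaSeries, coeff_mk, numFormulas_zero_left, coeff_C_mul,
    coeff_X]
  push_cast
  rw [add_div]
  congr 1
  split_ifs with h <;> simp [h]

theorem formulaSeries_succ (k : ℕ) : formulaSeries (k + 1) =
    ∑ p ∈ antidiagonal (k + 1), formulaSeries p.1 * formulaSeries p.2 +
      ∑ p ∈ antidiagonal k, convSeries p.1 p.2 := by
  ext n
  simp only [map_add, map_sum, coeff_formulaSeries_mul]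
  rw [formulaSeries, coeff_mk, numFormulas_succ_left]
  simp only [convSeries, coeff_mk]
  push_cast
  simp only [add_div, Finset.sum_div]

theorem one_sub_two_mul_sq : (1 - 2 * formulaSeries 0) ^ 2 = 1 - X := by
  have h : (4 : PowerSeries ℝ) * C (1 / 4) = 1 := by
    rw [← map_ofNat C 4, ← map_mul]
    norm_num
  linear_combination -4 * formulaSeries_zero - X * h

/-- Both sides are `(1 - X) ^ (1 / 2)`; the coefficients are compared through the closed form of the
Catalan numbers. -/
theorem one_sub_X_mul_halfBinom : (1 - X) * mk (halfBinom 0) = 1 - 2 * formulaSeries 0 := by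
  ext n
  rw [two_mul, map_sub, map_add, formulaSeries, coeff_mk]
  rcases n with _ | n
  · rw [coeff_mul_one_sub_X_zero, halfBinom.zero_right, numFormulas_value_zero]
    simp
  · rw [coeff_mul_one_sub_X_succ, halfBinom.zero_succ, numFormulas_zero_succ, coeff_one,
      if_neg (by omega), halfBinom]
    have h : ((n : ℝ) + 1) * catalan n = n.centralBinom := by
      exact_mod_cast succ_mul_catalan_eq_centralBinom n
    rw [← h, pow_succ]
    field_simp
    ring

theorem one_sub_X_ne_zero : (1 - X : PowerSeries ℝ) ≠ 0 := by
  intro h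
  have := congrArg (coeff 0) h
  simp at this

theorem one_sub_X_mul_halfBinom_sq : (1 - X) * (mk (halfBinom 0)) ^ 2 = 1 := by
  refine mul_left_cancel₀ one_sub_X_ne_zero ?_
  linear_combination ((1 - X) * mk (halfBinom 0) + (1 - 2 * formulaSeries 0)) *
    one_sub_X_mul_halfBinom + one_sub_two_mul_sq

theorem one_sub_X_pow_mul_halfBinom (k : ℕ) :
    (1 - X) ^ k * mk (halfBinom k) = mk (halfBinom 0) := by
  induction k with
  | zero => simp
  | succ k ih => rw [pow_succ, mul_assoc, halfBinom.one_sub_X_mul, ih]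

/-- The factor of `formulaSeries (k + 1)` that converges beyond `1`. -/
noncomputable def regularPart (k : ℕ) : PowerSeries ℝ :=
  (1 - X) ^ (k + 1) * formulaSeries (k + 1) * mk (halfBinom 0)

theorem formulaSeries_eq_regularPart_mul (k : ℕ) :
    formulaSeries (k + 1) = regularPart k * mk (halfBinom k) := by
  rw [regularPart]
  linear_combination -(formulaSeries (k + 1)) * one_sub_X_mul_halfBinom_sq -
    (1 - X) * formulaSeries (k + 1) * mk (halfBinom 0) * one_sub_X_pow_mul_halfBinom k

theorem regularPart_zero : regularPart 0 = convSeries 0 0 := by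
  have h := formulaSeries_succ 0
  simp only [Finset.Nat.antidiagonal_succ, Finset.Nat.antidiagonal_zero, Finset.sum_cons,
    Finset.map_singleton, Finset.sum_singleton, Function.Embedding.prodMap, zero_add,
    Function.Embedding.coeFn_mk, Prod.map, Function.Embedding.refl_apply, Nat.succ_eq_add_one] at h
  rw [regularPart]
  linear_combination formulaSeries 1 * one_sub_X_mul_halfBinom + h

/-- The two terms containing `formulaSeries 0`, moved to the left, leave the factor `1 - 2 *
formulaSeries 0 = (1 - X) * mk (halfBinom 0)`, which `regularPart` absorbs. -/
theorem regularPart_succ (k : ℕ) : regularPart (k + 1) =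
    ∑ p ∈ antidiagonal k, regularPart p.1 * regularPart p.2 +
      (1 - X) ^ (k + 1) * ∑ p ∈ antidiagonal (k + 1), convSeries p.1 p.2 := by
  have h := formulaSeries_succ (k + 1)
  rw [Finset.Nat.antidiagonal_succ_succ', Finset.sum_cons, Finset.sum_cons, Finset.sum_map] at h
  simp only [Function.Embedding.prodMap, Function.Embedding.coeFn_mk, Prod.map,
    Nat.succ_eq_add_one] at h
  have hs : ∑ p ∈ antidiagonal k, regularPart p.1 * regularPart p.2 = (1 - X) ^ (k + 1) *
      ∑ p ∈ antidiagonal k, formulaSeries (p.1 + 1) * formulaSeries (p.2 + 1) := by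
    rw [Finset.mul_sum]
    refine Finset.sum_congr rfl fun p hp => ?_
    rw [← mem_antidiagonal.1 hp, regularPart, regularPart]
    linear_combination (1 - X) ^ (p.1 + p.2 + 1) * formulaSeries (p.1 + 1) *
      formulaSeries (p.2 + 1) * one_sub_X_mul_halfBinom_sq
  rw [hs, regularPart]
  linear_combination (1 - X) ^ (k + 1) * formulaSeries (k + 2) * one_sub_X_mul_halfBinom +
    (1 - X) ^ (k + 1) * h

/-! ### Convergence of the regular parts beyond `1`. -/

theorem absSummableAt_halfBinom (k : ℕ) : AbsSummableAt (4 / 9) (mk (halfBinom k)) := by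
  induction k with
  | zero =>
    have hle (n : ℕ) : halfBinom 0 n ≤ 1 := by
      induction n with
      | zero => rw [halfBinom.zero_right]
      | succ n ih =>
        rw [halfBinom.zero_succ]
        refine mul_le_one₀ ih (by positivity) ?_
        rw [div_le_one (by positivity)]
        linarith
    refine Summable.of_nonneg_of_le (fun _ => norm_nonneg _) (fun n => ?_)
      (summable_geometric_of_lt_one (by norm_num : (0 : ℝ) ≤ 4 / 9) (by norm_num))
    have := halfBinom.pos 0 n
    rw [coeff_mk, Real.norm_of_nonneg (by positivity)]
    exact mul_le_of_le_one_left (by positivity) (hle n)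
  | succ k ih =>
    have hw : AbsSummableAt (4 / 9) (mk fun _ => (1 : ℝ)) := by
      refine (summable_geometric_of_lt_one (by norm_num : (0 : ℝ) ≤ 4 / 9) (by norm_num)).congr
        fun n => ?_
      rw [coeff_mk, one_mul, Real.norm_of_nonneg (by positivity)]
    have hw1 : (mk fun _ => (1 : ℝ)) * (1 - X) = 1 := mk_one_mul_one_sub_eq_one ℝ
    have : mk (halfBinom (k + 1)) = (mk fun _ => (1 : ℝ)) * mk (halfBinom k) := by
      rw [← halfBinom.one_sub_X_mul k, ← mul_assoc, hw1, one_mul]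
    rw [this]
    exact hw.mul ih

theorem absSummableAt_formulaSeries_zero : AbsSummableAt (4 / 9) (formulaSeries 0) := by
  have h : AbsSummableAt (4 / 9) (2 * formulaSeries 0) := by
    have : 2 * formulaSeries 0 = 1 - (1 - X) * mk (halfBinom 0) := by
      rw [one_sub_X_mul_halfBinom]; ring
    rw [this]
    exact AbsSummableAt.one.sub (AbsSummableAt.one_sub_X.mul (absSummableAt_halfBinom 0))
  refine Summable.of_nonneg_of_le (fun _ => norm_nonneg _) (fun n => ?_) h
  rw [two_mul, map_add, ← two_mul, mul_assoc, norm_mul 2]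
  rw [Real.norm_ofNat]
  linarith [norm_nonneg (coeff n (formulaSeries 0) * (4 / 9) ^ n)]

/-- The radius `4 / 9 < 1` is chosen so that the growth rate is `9`, whose square root `3` is less
than `4`. -/
theorem exists_numFormulas_le {k : ℕ} (h : AbsSummableAt (4 / 9) (formulaSeries k)) :
    ∃ K : ℝ, 0 ≤ K ∧ ∀ n, (numFormulas k n : ℝ) ≤ K * 9 ^ n := by
  obtain ⟨K, hK⟩ := h.bounded
  refine ⟨K, (norm_nonneg _).trans (hK 0), fun n => ?_⟩
  have := hK n
  have h4 : (numFormulas k n : ℝ) / 4 ^ n * (4 / 9) ^ n = numFormulas k n / 9 ^ n := by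
    rw [div_pow]
    field_simp
  rw [formulaSeries, coeff_mk, Real.norm_of_nonneg (by positivity), h4,
    div_le_iff₀ (by positivity)] at this
  exact this

theorem properConv_le {g h : ℕ → ℕ} {K L : ℝ} (hK : 0 ≤ K) (hL : 0 ≤ L)
    (hg : ∀ n, (g n : ℝ) ≤ K * 9 ^ n) (hh : ∀ n, (h n : ℝ) ≤ L * 9 ^ n) (n : ℕ) :
    (properConv g h n : ℝ) ≤ n * (K * L * 81 * 3 ^ n) := by
  have hterm (d : ℕ) (hd : d ∈ n.divisors.filter fun d => 1 < d ∧ d < n) :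
      (g d : ℝ) * h (n / d) ≤ K * L * 81 * 3 ^ n := by
    simp only [Finset.mem_filter, Nat.mem_divisors] at hd
    obtain ⟨⟨⟨e, rfl⟩, -⟩, hd1, hde⟩ := hd
    rw [Nat.mul_div_cancel_left _ (by omega)]
    have he : 2 ≤ e := by
      by_contra! h
      interval_cases e <;> omega
    -- This is `(d - 2) * (e - 2) ≥ 0`; it turns `9 ^ (d + e)` into at most `81 * 3 ^ (d * e)`.
    have hle : 2 * (d + e) ≤ d * e + 4 := by
      obtain ⟨a, rfl⟩ := Nat.exists_eq_add_of_le he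
      obtain ⟨b, rfl⟩ := Nat.exists_eq_add_of_le (show 2 ≤ d from hd1)
      nlinarith [Nat.zero_le (a * b)]
    calc (g d : ℝ) * h e ≤ (K * 9 ^ d) * (L * 9 ^ e) := by
          gcongr
          · exact hg d
          · exact hh e
      _ = K * L * 3 ^ (2 * (d + e)) := by rw [pow_mul, pow_add]; norm_num; ring
      _ ≤ K * L * 3 ^ (d * e + 4) := by gcongr; norm_num
      _ = K * L * 81 * 3 ^ (d * e) := by rw [pow_add]; ring
  rw [properConv, Nat.cast_sum]
  simp only [Nat.cast_mul]
  refine (Finset.sum_le_card_nsmul _ _ _ hterm).trans ?_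
  rw [nsmul_eq_mul]
  gcongr
  exact (Finset.card_filter_le _ _).trans (Nat.card_divisors_le_self n)

theorem absSummableAt_convSeries {i j : ℕ} (hi : AbsSummableAt (4 / 9) (formulaSeries i))
    (hj : AbsSummableAt (4 / 9) (formulaSeries j)) : AbsSummableAt (5 / 4) (convSeries i j) := by
  obtain ⟨K, hK, hi⟩ := exists_numFormulas_le hi
  obtain ⟨L, hL, hj⟩ := exists_numFormulas_le hj
  -- The ratio is `(3 / 4) * (5 / 4)`.
  have hr : ‖(15 / 16 : ℝ)‖ < 1 := by rw [Real.norm_of_nonneg] <;> norm_num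
  have hsum := (summable_pow_mul_geometric_of_norm_lt_one 1 hr).mul_left (K * L * 81)
  have hle (n : ℕ) : ‖coeff n (convSeries i j) * (5 / 4) ^ n‖ ≤
      K * L * 81 * ((n : ℝ) ^ 1 * (15 / 16) ^ n) := by
    rw [convSeries, coeff_mk, Real.norm_of_nonneg (by positivity)]
    have h := properConv_le hK hL hi hj n
    have h3 : (15 / 16 : ℝ) ^ n = 3 ^ n / 4 ^ n * (5 / 4) ^ n := by
      rw [← div_pow, ← mul_pow]; norm_num
    calc (properConv (numFormulas i) (numFormulas j) n : ℝ) / 4 ^ n * (5 / 4) ^ n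
        ≤ n * (K * L * 81 * 3 ^ n) / 4 ^ n * (5 / 4) ^ n := by gcongr
      _ = K * L * 81 * (n ^ 1 * (15 / 16) ^ n) := by rw [h3]; ring
  exact Summable.of_nonneg_of_le (fun _ => norm_nonneg _) hle hsum

/-- A bootstrap: earlier regular parts give `formulaSeries i` the radius `4 / 9` for `i ≤ k`, and
the proper convolution raises this to `5 / 4`. -/
theorem absSummableAt_regularPart (k : ℕ) : AbsSummableAt (5 / 4) (regularPart k) := by
  induction k using Nat.strong_induction_on with
  | _ k ih =>
    have hF (i : ℕ) (hi : i ≤ k) : AbsSummableAt (4 / 9) (formulaSeries i) := by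
      rcases i with _ | i
      · exact absSummableAt_formulaSeries_zero
      · rw [formulaSeries_eq_regularPart_mul]
        exact ((ih i hi).mono (by norm_num) (by norm_num)).mul (absSummableAt_halfBinom i)
    have hD : ∀ p ∈ antidiagonal k, AbsSummableAt (5 / 4) (convSeries p.1 p.2) := by
      intro p hp
      have := mem_antidiagonal.1 hp
      exact absSummableAt_convSeries (hF _ (by omega)) (hF _ (by omega))
    rcases k with _ | k
    · rw [regularPart_zero]
      exact hD (0, 0) (by simp)
    · rw [regularPart_succ]
      refine (AbsSummableAt.sum fun p hp => ?_).add
        ((AbsSummableAt.one_sub_X.pow _).mul (AbsSummableAt.sum hD))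
      have := mem_antidiagonal.1 hp
      exact (ih _ (by omega)).mul (ih _ (by omega))

theorem absSummableAt_formulaSeries (k : ℕ) : AbsSummableAt (4 / 9) (formulaSeries k) := by
  rcases k with _ | k
  · exact absSummableAt_formulaSeries_zero
  · rw [formulaSeries_eq_regularPart_mul]
    exact ((absSummableAt_regularPart k).mono (by norm_num) (by norm_num)).mul
      (absSummableAt_halfBinom k)

theorem absSummableAt_one_convSeries (i j : ℕ) : AbsSummableAt 1 (convSeries i j) :=
  (absSummableAt_convSeries (absSummableAt_formulaSeries i) (absSummableAt_formulaSeries j)).mono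
    (by norm_num) (by norm_num)

/-! ### Values at `1`, the constant `σ`, and the asymptotics. -/

theorem valueAtOne_regularPart (k : ℕ) : valueAtOne (regularPart k) =
    catalan k * valueAtOne (convSeries 0 0) ^ (k + 1) := by
  have h1 (i : ℕ) : AbsSummableAt 1 (regularPart i) :=
    (absSummableAt_regularPart i).mono (by norm_num) (by norm_num)
  induction k using Nat.strong_induction_on with
  | _ k ih =>
    rcases k with _ | k
    · simp [regularPart_zero]
    · have hD : AbsSummableAt 1 (∑ p ∈ antidiagonal (k + 1), convSeries p.1 p.2) :=
        AbsSummableAt.sum fun p _ => absSummableAt_one_convSeries p.1 p.2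
      have hp := (AbsSummableAt.one_sub_X (R := 1)).pow (k + 1)
      -- The convolution terms carry a power of `1 - X` and vanish at `1`; the Catalan recurrence
      -- remains.
      rw [regularPart_succ, valueAtOne_add (AbsSummableAt.sum fun p _ => (h1 _).mul (h1 _))
        (hp.mul hD), valueAtOne_mul hp hD, valueAtOne_one_sub_X_pow_succ, zero_mul, add_zero,
        valueAtOne_sum fun p _ => (h1 _).mul (h1 _), catalan_succ']
      push_cast
      rw [Finset.sum_mul]
      refine Finset.sum_congr rfl fun p hp => ?_
      have := mem_antidiagonal.1 hp
      rw [valueAtOne_mul (h1 _) (h1 _), ih _ (by omega), ih _ (by omega), ← this]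
      ring

theorem sigmaTerm_eq {m : ℕ} (hm : 0 < m) : sigmaTerm m = 4 * coeff m (convSeries 0 0) := by
  obtain ⟨n, rfl⟩ := Nat.exists_eq_succ_of_ne_zero hm.ne'
  rw [sigmaTerm, convSeries, coeff_mk, Nat.succ_sub_one, Nat.succ_eq_add_one, pow_succ]
  field_simp

theorem summable_sigmaTerm : Summable fun m : ℕ+ => sigmaTerm m := by
  have h := ((absSummableAt_one_convSeries 0 0).norm_coeff.of_norm.mul_left 4).comp_injective
    PNat.coe_injective
  exact h.congr fun m => (sigmaTerm_eq m.pos).symm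

theorem sigmaConst_eq : sigmaConst = 4 * valueAtOne (convSeries 0 0) := by
  rw [sigmaConst, valueAtOne, ← tsum_mul_left, ← PNat.coe_injective.tsum_eq]
  · exact tsum_congr fun m => sigmaTerm_eq m.pos
  · intro n hn
    rcases Nat.eq_zero_or_pos n with rfl | h
    · simp [convSeries, properConv] at hn
    · exact ⟨⟨n, h⟩, rfl⟩

/-- Positivity keeps the claimed main term nonzero, so that the equivalence is a limit of ratios.
The least composite number, `4`, already gives a positive term. -/
theorem sigmaConst_pos : 0 < sigmaConst := by
  refine summable_sigmaTerm.tsum_pos (fun m => ?_) 4 ?_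
  · rw [sigmaTerm]; positivity
  · have h : properConv (numFormulas 0) (numFormulas 0) 4 = 1 := by
      have h2 : numFormulas 0 2 = 1 := by rw [numFormulas_zero_succ 1, catalan_one]
      have hd : (Nat.divisors 4).filter (fun d => 1 < d ∧ d < 4) = {2} := by decide
      rw [properConv, hd]
      simp [h2]
    have h4 : ((4 : ℕ+) : ℕ) = 4 := rfl
    rw [sigmaTerm, h4, h]
    norm_num

open Topology in
theorem tendsto_numFormulas (k : ℕ) :
    Tendsto (fun n : ℕ => (numFormulas k n : ℝ) / 4 ^ n / (n : ℝ) ^ ((k : ℝ) - 3 / 2)) atTop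
      (𝓝 (sigmaConst ^ k / (4 * √Real.pi * (k.factorial : ℝ)))) := by
  have hπ : √Real.pi ≠ 0 := (Real.sqrt_pos.2 Real.pi_pos).ne'
  rcases k with _ | k
  -- For `k = 0` there is no regular part; for `n ≥ 1` the exact ratio of `numFormulas 0 n / 4 ^ n`
  -- to `halfBinom 0 n` is `1 / (4 * (n - 1 / 2))`.
  · have h1 : Tendsto (fun n : ℕ => (1 / 4 : ℝ) * (1 - (1 / 2) / (n : ℝ))⁻¹) atTop
        (𝓝 ((1 / 4) * (1 - 0)⁻¹)) :=
      ((tendsto_const_nhds.sub (tendsto_const_div_atTop_nhds_zero_nat _)).inv₀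
        (by norm_num)).const_mul _
    convert ((halfBinom.tendsto 0).mul h1).congr' ?_ using 2
    · simp
    · filter_upwards [eventually_gt_atTop 0] with n hn
      obtain ⟨m, rfl⟩ := Nat.exists_eq_succ_of_ne_zero hn.ne'
      have hn' : (0 : ℝ) < (m + 1 : ℕ) := by positivity
      have he : ((0 : ℕ) : ℝ) - 1 / 2 = ((0 : ℕ) - 3 / 2) + 1 := by norm_num
      have hc : ((m : ℝ) + 1) * catalan m = m.centralBinom := by
        exact_mod_cast succ_mul_catalan_eq_centralBinom m
      have hx := (Real.rpow_pos_of_pos hn' (((0 : ℕ) : ℝ) - 3 / 2)).ne'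
      have hm : (1 : ℝ) - 1 / 2 / (m + 1) = (m + 1 / 2) / (m + 1) := by field_simp; ring
      rw [Nat.succ_eq_add_one, he, Real.rpow_add_one hn'.ne', numFormulas_zero_succ,
        halfBinom.zero_succ, halfBinom, ← hc]
      push_cast at hx ⊢
      rw [hm, pow_succ]
      field_simp
  · have h := halfBinom.tendsto_coeff_mul k (absSummableAt_regularPart k) (halfBinom.tendsto k)
    rw [← formulaSeries_eq_regularPart_mul, valueAtOne_regularPart] at h
    convert h using 2
    · rw [formulaSeries, coeff_mk]
      congr 2
      push_cast
      ring
    · have hc : (catalan k : ℝ) ≠ 0 := by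
        have h := succ_mul_catalan_eq_centralBinom k
        have h' := k.centralBinom_ne_zero
        rw [← h] at h'
        exact_mod_cast right_ne_zero_of_mul h'
      rw [sigmaConst_eq]
      field_simp
      ring

end ArithExpr

theorem theorem2 :
    Summable (fun m : ℕ+ => sigmaTerm m) ∧
    ∀ k : ℕ,
      (fun n : ℕ => (numFormulas k n : ℝ)) ~[atTop]
        (fun n : ℕ => sigmaConst ^ k / (4 * √Real.pi * (k.factorial : ℝ)) *
          4 ^ n * (n : ℝ) ^ ((k : ℝ) - 3 / 2)) := by
  refine ⟨ArithExpr.summable_sigmaTerm, fun k => ?_⟩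
  have hσ := ArithExpr.sigmaConst_pos
  have hc : 0 < sigmaConst ^ k / (4 * √Real.pi * (k.factorial : ℝ)) := by
    have := Real.pi_pos
    positivity
  have hne : ∀ᶠ n : ℕ in atTop, sigmaConst ^ k / (4 * √Real.pi * (k.factorial : ℝ)) *
      4 ^ n * (n : ℝ) ^ ((k : ℝ) - 3 / 2) ≠ 0 := by
    filter_upwards [eventually_gt_atTop 0] with n hn
    have : (0 : ℝ) < n := by exact_mod_cast hn
    positivity
  rw [isEquivalent_iff_tendsto_one hne]
  have h := (ArithExpr.tendsto_numFormulas k).div_const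
    (sigmaConst ^ k / (4 * √Real.pi * (k.factorial : ℝ)))
  rw [div_self hc.ne'] at h
  refine h.congr fun n => ?_
  rw [Pi.div_apply, div_div, div_div]
  congr 1
  ring
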